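/- For a nonnegative integer $m$ let $s_2(m)$ denote the sum of the binary digits of $m$, and write $e(x)=e^{2\pi i x}$. There is a unique real number $\rho>0$ (the Fouvry–Mauduit constant) for which there exist constants $0<c\le C$ with $$c\,\rho^{\lambda}\ \le\ \int_0^1\prod_{0\le k<\lambda}\bigl|\sin(2^k\pi\theta)\bigr|\,d\theta\ \le\ C\rho^{\lambda}\qquad\text{for all integers }\lambda\ge 0,$$ and it satisfies $0.6543<\rho<0.6632$. With this $\rho$ there is an absolute constant $C'>0$ such that for all real $z\ge 1$ $$\int_0^1\ \sup_{x\ge 0}\ \Bigl|\sum_{x<m\le x+z}(-1)^{s_2(m)}e(m\theta)\Bigr|\,d\theta\ \le\ C'\,z^{\,1+\frac{\log\rho}{\log 2}},$$ where the supremum is over all real $x\ge 0$ and $m$ runs over integers. -/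

import Mathlib

open scoped BigOperators

noncomputable section

/-- `s₂ n`: the sum of the digits of `n` in base `2`. -/
def binDigitSum (n : ℕ) : ℕ := (Nat.digits 2 n).sum

/-- `e(x) = exp (2 π i x)`. -/
def unitExp (x : ℝ) : ℂ := Complex.exp (2 * (Real.pi : ℂ) * Complex.I * (x : ℂ))

/-- The exponential sum `∑_{x < m ≤ x + z} (-1)^{s₂(m)} e(m θ)`, used for `x, z ≥ 0`. -/
def thueMorseSum (x z θ : ℝ) : ℂ :=
  ∑ m ∈ Finset.Ioc ⌊x⌋₊ ⌊x + z⌋₊, (-1 : ℂ) ^ binDigitSum m * unitExp ((m : ℝ) * θ)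

/-- `sup_{x ≥ 0} |∑_{x < m ≤ x + z} (-1)^{s₂(m)} e(m θ)|`, over real `x ≥ 0`. -/
def thueMorseSup (z θ : ℝ) : ℝ := ⨆ x : Set.Ici (0 : ℝ), ‖thueMorseSum (x : ℝ) z θ‖

/-- `∫₀¹ ∏_{0 ≤ k < l} |sin (2 ^ k π θ)| dθ`. -/
def sinProdIntegral (l : ℕ) : ℝ :=
  ∫ θ in (0 : ℝ)..1, ∏ k ∈ Finset.range l, |Real.sin (2 ^ k * Real.pi * θ)|

/-- `ρ > 0` is the exponential growth rate of the integrals above, up to constant factors: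
`∫₀¹ ∏_{0 ≤ k < l} |sin (2 ^ k π θ)| dθ ≍ ρ ^ l` for all `l ≥ 0`. -/
def IsSinProdRate (ρ : ℝ) : Prop :=
  0 < ρ ∧ ∃ c C : ℝ, 0 < c ∧ 0 < C ∧
    ∀ l : ℕ, c * ρ ^ l ≤ sinProdIntegral l ∧ sinProdIntegral l ≤ C * ρ ^ l

theorem norm_unitExp (x : ℝ) : ‖unitExp x‖ = 1 := by
  have h : (2 * (Real.pi : ℂ) * Complex.I * (x : ℂ)) = ((2 * Real.pi * x : ℝ) : ℂ) * Complex.I := by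
    push_cast; ring
  rw [unitExp, h, Complex.norm_exp_ofReal_mul_I]

/-- The index set of the sum is `{m : x < m ≤ x + z}`. -/
theorem mem_thueMorse_index {x z : ℝ} (hx : 0 ≤ x) (hz : 0 ≤ z) (m : ℕ) :
    m ∈ Finset.Ioc ⌊x⌋₊ ⌊x + z⌋₊ ↔ x < m ∧ (m : ℝ) ≤ x + z := by
  rw [Finset.mem_Ioc, Nat.floor_lt hx, Nat.le_floor_iff (add_nonneg hx hz)]

/-- The supremum in `thueMorseSup` is over a set of reals that is bounded above. -/
theorem thueMorseSup_bddAbove {z : ℝ} (hz : 0 ≤ z) (θ : ℝ) :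
    BddAbove (Set.range fun x : Set.Ici (0 : ℝ) => ‖thueMorseSum (x : ℝ) z θ‖) := by
  refine ⟨z + 1, ?_⟩
  rintro _ ⟨⟨x, hx⟩, rfl⟩
  have hx' : 0 ≤ x := hx
  have h1 : ‖thueMorseSum x z θ‖ ≤ ((⌊x + z⌋₊ - ⌊x⌋₊ : ℕ) : ℝ) := by
    refine (norm_sum_le _ _).trans ?_
    simp [norm_unitExp]
  have h2 : ⌊x⌋₊ ≤ ⌊x + z⌋₊ := Nat.floor_mono (by linarith)
  rw [Nat.cast_sub h2] at h1
  have h3 := Nat.floor_le (add_nonneg hx' hz)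
  have h4 := Nat.lt_floor_add_one x
  show ‖thueMorseSum x z θ‖ ≤ z + 1
  linarith

end

/-! Pairing the terms `2 * m` and `2 * m + 1` of the Thue–Morse sum at `θ` produces the factor `1 -
unitExp θ`, of modulus `2 * |sin (π * θ)|`, times a sum of half the length at `2 * θ`. Iterating
bounds the sum, uniformly in `x`, by `2 * ∑ 2 ^ l * sinProd l θ` over `l ≤ N`, where `2 ^ N` is
comparable to `z`. After integration this is a geometric sum of ratio `2 * ρ > 1`, hence of order
`(2 * ρ) ^ N`, which is the claimed power of `z`.

The rate `ρ` comes from the transfer operator `sinTransfer`: `sinProdIntegral n` is the integral of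
its `n`-th iterate on `1`. These iterates stay in a cone of functions with minimum at `0` and
maximum at `1 / 2` (`SinTransferCone.sinTransfer`), and their maximum is at most twice their
minimum. So the maxima are multiplicative up to a factor `2`, and Fekete's lemma gives a pure
exponential rate. Comparison with the near-eigenfunctions `sinTest b` locates `ρ` numerically. -/

open Real Set

/-! ### The folded transfer operator -/

/-- The transfer operator of the doubling map with weight `|sin (π x)|`, acting on functions
invariant under `x ↦ 1 - x`. -/
noncomputable def sinTransfer (g : ℝ → ℝ) (x : ℝ) : ℝ :=
  (sin (π / 2 * x) * g (x / 2) + cos (π / 2 * x) * g ((1 - x) / 2)) / 2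

theorem sinTransfer_one_sub (g : ℝ → ℝ) (x : ℝ) : sinTransfer g (1 - x) = sinTransfer g x := by
  have h1 : sin (π / 2 * (1 - x)) = cos (π / 2 * x) := by
    rw [← sin_pi_div_two_sub]; ring_nf
  have h2 : cos (π / 2 * (1 - x)) = sin (π / 2 * x) := by
    rw [← cos_pi_div_two_sub]; ring_nf
  simp only [sinTransfer, h1, h2, sub_sub_cancel]
  ring

theorem sinTransfer_continuous {g : ℝ → ℝ} (hg : Continuous g) : Continuous (sinTransfer g) := by
  unfold sinTransfer; fun_prop

theorem sin_pi_div_two_mul_nonneg {x : ℝ} (hx : x ∈ Icc (0 : ℝ) 1) : 0 ≤ sin (π / 2 * x) :=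
  sin_nonneg_of_nonneg_of_le_pi (mul_nonneg (by positivity) hx.1)
    (by nlinarith [pi_pos, hx.2])

theorem cos_pi_div_two_mul_nonneg {x : ℝ} (hx : x ∈ Icc (0 : ℝ) 1) : 0 ≤ cos (π / 2 * x) :=
  cos_nonneg_of_neg_pi_div_two_le_of_le (by nlinarith [pi_pos, hx.1])
    (by nlinarith [pi_pos, hx.2])

theorem sinTransfer_mono {g h : ℝ → ℝ} (hgh : ∀ x ∈ Icc (0 : ℝ) 1, g x ≤ h x) :
    ∀ x ∈ Icc (0 : ℝ) 1, sinTransfer g x ≤ sinTransfer h x := by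
  intro x hx
  have h1 := hgh (x / 2) ⟨by linarith [hx.1], by linarith [hx.2]⟩
  have h2 := hgh ((1 - x) / 2) ⟨by linarith [hx.2], by linarith [hx.1]⟩
  have hs := sin_pi_div_two_mul_nonneg hx
  have hc := cos_pi_div_two_mul_nonneg hx
  unfold sinTransfer
  gcongr

theorem sinTransfer_iterate_mono {g h : ℝ → ℝ} (hgh : ∀ x ∈ Icc (0 : ℝ) 1, g x ≤ h x) (n : ℕ) :
    ∀ x ∈ Icc (0 : ℝ) 1, sinTransfer^[n] g x ≤ sinTransfer^[n] h x := by
  induction n with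
  | zero => exact hgh
  | succ n ih =>
    simp only [Function.iterate_succ_apply']
    exact sinTransfer_mono ih

theorem sinTransfer_smul (a : ℝ) (g : ℝ → ℝ) : sinTransfer (a • g) = a • sinTransfer g := by
  ext x; simp only [sinTransfer, Pi.smul_apply, smul_eq_mul]; ring

theorem sinTransfer_iterate_smul (a : ℝ) (g : ℝ → ℝ) (n : ℕ) :
    sinTransfer^[n] (a • g) = a • sinTransfer^[n] g := by
  induction n with
  | zero => rfl
  | succ n ih => simp only [Function.iterate_succ_apply', ih, sinTransfer_smul]

theorem sinTransfer_iterate_continuous {g : ℝ → ℝ} (hg : Continuous g) (n : ℕ) :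
    Continuous (sinTransfer^[n] g) := by
  induction n with
  | zero => exact hg
  | succ n ih => rw [Function.iterate_succ_apply']; exact sinTransfer_continuous ih

theorem sinTransfer_iterate_le_of_le {g : ℝ → ℝ} {κ : ℝ} (hκ : 0 ≤ κ)
    (h : ∀ x ∈ Icc (0 : ℝ) 1, sinTransfer g x ≤ κ * g x) (n : ℕ) :
    ∀ x ∈ Icc (0 : ℝ) 1, sinTransfer^[n] g x ≤ κ ^ n * g x := by
  induction n with
  | zero => simp
  | succ n ih =>
    intro x hx
    rw [Function.iterate_succ_apply']
    calc sinTransfer (sinTransfer^[n] g) x ≤ sinTransfer (κ ^ n • g) x :=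
          sinTransfer_mono (by simpa using ih) x hx
      _ = κ ^ n * sinTransfer g x := by simp [sinTransfer_smul]
      _ ≤ κ ^ n * (κ * g x) := by gcongr; exact h x hx
      _ = κ ^ (n + 1) * g x := by ring

theorem le_sinTransfer_iterate_of_le {g : ℝ → ℝ} {κ : ℝ} (hκ : 0 ≤ κ)
    (h : ∀ x ∈ Icc (0 : ℝ) 1, κ * g x ≤ sinTransfer g x) (n : ℕ) :
    ∀ x ∈ Icc (0 : ℝ) 1, κ ^ n * g x ≤ sinTransfer^[n] g x := by
  induction n with
  | zero => simp
  | succ n ih =>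
    intro x hx
    rw [Function.iterate_succ_apply']
    calc κ ^ (n + 1) * g x = κ ^ n * (κ * g x) := by ring
      _ ≤ κ ^ n * sinTransfer g x := by gcongr; exact h x hx
      _ = sinTransfer (κ ^ n • g) x := by simp [sinTransfer_smul]
      _ ≤ sinTransfer (sinTransfer^[n] g) x := sinTransfer_mono (by simpa using ih) x hx

/-! ### An invariant cone -/

/-- A cone of functions, concave on `[0, 1/2]` and symmetric about `1/2`, which is stable under
`sinTransfer`. -/
def SinTransferCone (g : ℝ → ℝ) : Prop :=
  ∃ g₁ g₂ : ℝ → ℝ, (∀ x, HasDerivAt g (g₁ x) x) ∧ (∀ x, HasDerivAt g₁ (g₂ x) x) ∧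
    (∀ x, g (1 - x) = g x) ∧ (∀ x ∈ Icc (0 : ℝ) (1 / 2), g₂ x ≤ 0) ∧ 0 < g 0 ∧
    g₁ 0 ≤ π / 2 * g 0

theorem deriv_half_eq_zero_of_symm {g : ℝ → ℝ} {d : ℝ} (h : HasDerivAt g d (1 / 2))
    (hs : ∀ x, g (1 - x) = g x) : d = 0 := by
  have h1 : HasDerivAt (fun x : ℝ => g (1 - x)) (d * -1) (1 / 2) := by
    refine HasDerivAt.comp (1 / 2 : ℝ) (h₂ := g) (h := fun x => 1 - x) ?_ ?_
    · rwa [show (1 : ℝ) - 1 / 2 = 1 / 2 by norm_num]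
    · exact (hasDerivAt_id' _).const_sub 1
  simp only [hs] at h1
  linarith [h.unique h1]

theorem antitoneOn_Icc_half {g g₁ : ℝ → ℝ} (h : ∀ x, HasDerivAt g (g₁ x) x)
    (hn : ∀ x ∈ Icc (0 : ℝ) (1 / 2), g₁ x ≤ 0) : AntitoneOn g (Icc 0 (1 / 2)) := by
  refine antitoneOn_of_deriv_nonpos (convex_Icc _ _)
    (fun x _ => (h x).continuousAt.continuousWithinAt)
    (fun x _ => (h x).differentiableAt.differentiableWithinAt) fun x hx => ?_
  rw [(h x).deriv]
  exact hn x (interior_subset hx)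

theorem antitoneOn_deriv_and_monotoneOn {g g₁ g₂ : ℝ → ℝ} (h1 : ∀ x, HasDerivAt g (g₁ x) x)
    (h2 : ∀ x, HasDerivAt g₁ (g₂ x) x) (hs : ∀ x, g (1 - x) = g x)
    (hn : ∀ x ∈ Icc (0 : ℝ) (1 / 2), g₂ x ≤ 0) :
    AntitoneOn g₁ (Icc 0 (1 / 2)) ∧ MonotoneOn g (Icc 0 (1 / 2)) := by
  have ha := antitoneOn_Icc_half h2 hn
  have h0 : g₁ (1 / 2) = 0 := deriv_half_eq_zero_of_symm (h1 _) hs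
  refine ⟨ha, ?_⟩
  have := antitoneOn_Icc_half (g := fun x => - g x) (fun x => (h1 x).neg) fun x hx => by
    have := ha hx (right_mem_Icc.2 (by norm_num)) hx.2
    linarith
  intro x hx y hy hxy
  have := this hx hy hxy
  simpa using this

theorem SinTransferCone.bounds {g : ℝ → ℝ} (hg : SinTransferCone g) :
    ∀ x ∈ Icc (0 : ℝ) 1, g 0 ≤ g x ∧ g x ≤ g (1 / 2) := by
  obtain ⟨g₁, g₂, h1, h2, hs, hn, -, -⟩ := hg
  have hm := (antitoneOn_deriv_and_monotoneOn h1 h2 hs hn).2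
  have key : ∀ x ∈ Icc (0 : ℝ) (1 / 2), g 0 ≤ g x ∧ g x ≤ g (1 / 2) := fun x hx =>
    ⟨hm (left_mem_Icc.2 (by norm_num)) hx hx.1, hm hx (right_mem_Icc.2 (by norm_num)) hx.2⟩
  intro x hx
  rcases le_total x (1 / 2) with h | h
  · exact key x ⟨hx.1, h⟩
  · rw [← hs x]
    exact key (1 - x) ⟨by linarith [hx.2], by linarith⟩

/-- With `g ≥ g 0` and `g₁ ≤ g₁ 0 ≤ π / 2 * g 0`, the first-derivative terms of the new second
derivative are absorbed by those with `-(π / 2) ^ 2`. The slope condition reproduces itself: since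
`g₁ (1 / 2) = 0`, the new slope at `0` is `π / 4 * g 0`, at most `π / 4 * g (1 / 2)`, which is `π /
2` times the new value at `0`. -/
theorem SinTransferCone.sinTransfer {g : ℝ → ℝ} (hg : SinTransferCone g) :
    SinTransferCone (sinTransfer g) := by
  have hb := hg.bounds
  obtain ⟨g₁, g₂, h1, h2, hs, hn, h0, hd⟩ := hg
  have ha := (antitoneOn_deriv_and_monotoneOn h1 h2 hs hn).1
  have hS : ∀ x : ℝ, HasDerivAt (fun x : ℝ => sin (π / 2 * x)) (π / 2 * cos (π / 2 * x)) x := by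
    intro x
    have := ((hasDerivAt_id' x).const_mul (π / 2)).sin
    convert this using 1; ring
  have hC : ∀ x : ℝ, HasDerivAt (fun x : ℝ => cos (π / 2 * x)) (-(π / 2 * sin (π / 2 * x))) x := by
    intro x
    have := ((hasDerivAt_id' x).const_mul (π / 2)).cos
    convert this using 1; ring
  have hl : ∀ {u v : ℝ → ℝ} (_ : ∀ x, HasDerivAt u (v x) x) (x : ℝ),
      HasDerivAt (fun x => u (x / 2)) (v (x / 2) * (1 / 2)) x := fun huv x =>
    HasDerivAt.comp x (huv _) ((hasDerivAt_id' x).div_const 2)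
  have hr : ∀ {u v : ℝ → ℝ} (_ : ∀ x, HasDerivAt u (v x) x) (x : ℝ),
      HasDerivAt (fun x => u ((1 - x) / 2)) (v ((1 - x) / 2) * (-1 / 2)) x := fun huv x =>
    HasDerivAt.comp x (huv _) (((hasDerivAt_id' x).const_sub 1).div_const 2)
  refine ⟨fun x => (π / 2 * (cos (π / 2 * x) * g (x / 2) - sin (π / 2 * x) * g ((1 - x) / 2)) +
      (sin (π / 2 * x) * g₁ (x / 2) - cos (π / 2 * x) * g₁ ((1 - x) / 2)) / 2) / 2,
    fun x => (-(π / 2) ^ 2 * (sin (π / 2 * x) * g (x / 2) + cos (π / 2 * x) * g ((1 - x) / 2)) +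
      π / 2 * (cos (π / 2 * x) * g₁ (x / 2) + sin (π / 2 * x) * g₁ ((1 - x) / 2)) +
      (sin (π / 2 * x) * g₂ (x / 2) + cos (π / 2 * x) * g₂ ((1 - x) / 2)) / 4) / 2,
    ?_, ?_, sinTransfer_one_sub g, ?_, ?_, ?_⟩
  · intro x
    have := (((hS x).mul (hl h1 x)).add ((hC x).mul (hr h1 x))).div_const 2
    refine this.congr_deriv ?_
    ring
  · intro x
    have := (((((hC x).mul (hl h1 x)).sub ((hS x).mul (hr h1 x))).const_mul (π / 2)).add
      ((((hS x).mul (hl h2 x)).sub ((hC x).mul (hr h2 x))).div_const 2)).div_const 2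
    refine this.congr_deriv ?_
    ring
  · intro x hx
    have hx1 : x ∈ Icc (0 : ℝ) 1 := ⟨hx.1, by linarith [hx.2]⟩
    have hl' : x / 2 ∈ Icc (0 : ℝ) (1 / 2) := ⟨by linarith [hx.1], by linarith [hx.2]⟩
    have hr' : (1 - x) / 2 ∈ Icc (0 : ℝ) (1 / 2) := ⟨by linarith [hx.2], by linarith [hx.1]⟩
    have hz : (0 : ℝ) ∈ Icc (0 : ℝ) (1 / 2) := left_mem_Icc.2 (by norm_num)
    have hs0 := sin_pi_div_two_mul_nonneg hx1
    have hc0 := cos_pi_div_two_mul_nonneg hx1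
    have e1 := mul_nonneg hs0 (sub_nonneg.2 (hb (x / 2) ⟨hl'.1, by linarith [hl'.2]⟩).1)
    have e2 := mul_nonneg hc0 (sub_nonneg.2 (hb ((1 - x) / 2) ⟨hr'.1, by linarith [hr'.2]⟩).1)
    have e3 := mul_nonneg hc0 (sub_nonneg.2 ((ha hz hl' hl'.1).trans hd))
    have e4 := mul_nonneg hs0 (sub_nonneg.2 ((ha hz hr' hr'.1).trans hd))
    have e5 := mul_nonneg hs0 (neg_nonneg.2 (hn _ hl'))
    have e6 := mul_nonneg hc0 (neg_nonneg.2 (hn _ hr'))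
    have hp := pi_pos
    have e7 := mul_nonneg (sq_nonneg (π / 2)) (add_nonneg e1 e2)
    have e8 := mul_nonneg (by positivity : 0 ≤ π / 2) (add_nonneg e3 e4)
    linarith
  · have := (hb (1 / 2) ⟨by norm_num, by norm_num⟩).1
    simp [_root_.sinTransfer]
    norm_num at this
    linarith
  · have h3 := (hb (1 / 2) ⟨by norm_num, by norm_num⟩).1
    have h4 : g₁ (1 / 2) = 0 := deriv_half_eq_zero_of_symm (h1 _) hs
    have h5 := mul_le_mul_of_nonneg_left h3 pi_pos.le
    norm_num at h4 h5
    simp [_root_.sinTransfer]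
    linarith

theorem sinTransferCone_one : SinTransferCone 1 := by
  refine ⟨0, 0, fun x => hasDerivAt_const x 1, fun x => hasDerivAt_const x 0, ?_, ?_, ?_, ?_⟩
  · simp
  · simp
  · simp
  · simp; positivity

theorem sinTransferCone_iterate (n : ℕ) : SinTransferCone (sinTransfer^[n] 1) := by
  induction n with
  | zero => exact sinTransferCone_one
  | succ n ih => rw [Function.iterate_succ_apply']; exact ih.sinTransfer

theorem sinTransfer_zero (g : ℝ → ℝ) : sinTransfer g 0 = g (1 / 2) / 2 := by
  simp [sinTransfer]

/-! ### Quasi-multiplicativity of the maxima -/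

/-- The maximum of `sinTransfer^[n] 1` on `[0, 1]`. -/
noncomputable def sinTransferMax (n : ℕ) : ℝ := sinTransfer^[n] 1 (1 / 2)

theorem sinTransfer_iterate_le_max (n : ℕ) :
    ∀ x ∈ Icc (0 : ℝ) 1, sinTransfer^[n] 1 x ≤ sinTransferMax n := fun x hx =>
  ((sinTransferCone_iterate n).bounds x hx).2

theorem half_mem_Icc : (1 / 2 : ℝ) ∈ Icc (0 : ℝ) 1 := ⟨by norm_num, by norm_num⟩

theorem sinTransferMax_pos (n : ℕ) : 0 < sinTransferMax n := by
  have h := sinTransferCone_iterate n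
  have := (h.bounds (1 / 2) half_mem_Icc).1
  obtain ⟨_, _, _, _, _, _, h0, _⟩ := h
  exact h0.trans_le this

theorem sinTransferMax_add_le (m n : ℕ) :
    sinTransferMax (m + n) ≤ sinTransferMax m * sinTransferMax n := by
  have := sinTransfer_iterate_mono (h := sinTransferMax m • 1)
    (by simpa using sinTransfer_iterate_le_max m) n (1 / 2) half_mem_Icc
  rw [← Function.iterate_add_apply, sinTransfer_iterate_smul] at this
  rw [add_comm m n]
  exact this

theorem sinTransferMax_succ_le (n : ℕ) : sinTransferMax (n + 1) ≤ sinTransferMax n := by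
  have h1 : sinTransferMax 1 ≤ 1 := by
    have h2 := sin_le_one (π / 2 * (1 / 2))
    have h3 := cos_le_one (π / 2 * (1 / 2))
    simp only [sinTransferMax, Function.iterate_one, sinTransfer, Pi.one_apply]
    linarith
  calc _ ≤ _ := sinTransferMax_add_le n 1
    _ ≤ sinTransferMax n * 1 := by gcongr; exact (sinTransferMax_pos n).le
    _ = _ := mul_one _

/-- The minimum is at `0`, where `sinTransfer` returns half the preceding maximum; the maxima
decrease with `n`. -/
theorem half_max_le_sinTransfer_iterate (n : ℕ) :
    ∀ x ∈ Icc (0 : ℝ) 1, sinTransferMax n / 2 ≤ sinTransfer^[n] 1 x := by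
  intro x hx
  refine le_trans ?_ ((sinTransferCone_iterate n).bounds x hx).1
  cases n with
  | zero => norm_num [sinTransferMax]
  | succ n =>
    have := sinTransferMax_succ_le n
    rw [Function.iterate_succ_apply', sinTransfer_zero]
    change _ ≤ sinTransferMax n / 2
    linarith

theorem le_sinTransferMax_add (m n : ℕ) :
    1 / 2 * (sinTransferMax m * sinTransferMax n) ≤ sinTransferMax (m + n) := by
  have := sinTransfer_iterate_mono (g := (sinTransferMax m / 2) • 1)
    (by simpa using half_max_le_sinTransfer_iterate m) n (1 / 2) half_mem_Icc
  rw [← Function.iterate_add_apply, sinTransfer_iterate_smul] at this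
  rw [add_comm m n]
  refine le_trans (le_of_eq ?_) this
  simp only [Pi.smul_apply, smul_eq_mul, sinTransferMax]
  ring

/-! ### Exponential rates -/

/-- A positive sequence which is multiplicative up to a constant factor grows like a power. -/
theorem exists_rate_of_quasi_multiplicative {a : ℕ → ℝ} {c : ℝ} (hc : 0 < c) (ha : ∀ n, 0 < a n)
    (hle : ∀ m n, a (m + n) ≤ a m * a n) (hge : ∀ m n, c * (a m * a n) ≤ a (m + n)) :
    ∃ ρ : ℝ, 0 < ρ ∧ ∀ n, ρ ^ n ≤ a n ∧ c * a n ≤ ρ ^ n := by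
  -- Fekete's lemma applies to both sequences. Their limits are opposite, so the two infimum bounds
  -- enclose `log (a n)` from both sides.
  set u : ℕ → ℝ := fun n => log (a n)
  set v : ℕ → ℝ := fun n => -log (a n) - log c
  have hu : Subadditive u := fun m n => by
    have := log_le_log (ha _) (hle m n)
    rwa [log_mul (ha m).ne' (ha n).ne'] at this
  have hv : Subadditive v := fun m n => by
    have := log_le_log (mul_pos hc (mul_pos (ha m) (ha n))) (hge m n)
    rw [log_mul hc.ne' (mul_pos (ha m) (ha n)).ne', log_mul (ha m).ne' (ha n).ne'] at this
    simp only [v]; linarith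
  have hun : ∀ n, u n ≤ n * u 1 + u 0 := by
    intro n
    induction n with
    | zero => simp
    | succ n ih => have := hu n 1; push_cast; linarith
  have hvn : ∀ n, v n ≤ n * v 1 + v 0 := by
    intro n
    induction n with
    | zero => simp
    | succ n ih => have := hv n 1; push_cast; linarith
  have hdiv : ∀ (w w' : ℕ → ℝ) (K : ℝ), (∀ n, w' n ≤ n * w' 1 + w' 0) → (∀ n, w n = -w' n + K) →
      BddBelow (range fun n : ℕ => w n / n) := by
    intro w w' K h1 h2
    refine ⟨-(|w' 1| + |w' 0| + |K|), ?_⟩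
    rintro _ ⟨n, rfl⟩
    rcases Nat.eq_zero_or_pos n with rfl | hn
    · simp only [Nat.cast_zero, div_zero]
      linarith [abs_nonneg (w' 1), abs_nonneg (w' 0), abs_nonneg K]
    have hn' : (1 : ℝ) ≤ n := by exact_mod_cast hn
    simp only
    rw [le_div_iff₀ (by linarith), h2 n]
    have e0 := h1 n
    have e1 := mul_le_mul_of_nonneg_left (le_abs_self (w' 1)) (by linarith : (0 : ℝ) ≤ n)
    have e2 := mul_le_mul_of_nonneg_right hn' (abs_nonneg (w' 0))
    have e3 := mul_le_mul_of_nonneg_right hn' (abs_nonneg K)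
    linarith [le_abs_self (w' 0), neg_abs_le K]
  have hbu := hdiv u v (-log c) hvn fun n => by simp only [u, v]; ring
  have hbv := hdiv v u (-log c) hun fun n => by simp only [u, v]; ring
  have hlim : hv.lim = -hu.lim := by
    have h1 := hu.tendsto_lim hbu
    have h2 := hv.tendsto_lim hbv
    have h3 := (h1.neg).sub (tendsto_const_div_atTop_nhds_zero_nat (log c))
    rw [sub_zero] at h3
    refine tendsto_nhds_unique h2 (h3.congr fun n => ?_)
    simp only [u, v]; ring
  refine ⟨exp hu.lim, exp_pos _, fun n => ?_⟩
  rw [← exp_nat_mul]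
  -- The Fekete bound needs `n ≠ 0`; at `n = 0` the two hypotheses give `1 ≤ a 0` and `c * a 0 ≤ 1`.
  rcases Nat.eq_zero_or_pos n with rfl | hn
  · have h1 := hle 0 0
    have h2 := hge 0 0
    have h3 := ha 0
    simp only [add_zero] at h1 h2
    simp only [Nat.cast_zero, zero_mul, exp_zero]
    constructor <;> by_contra! h
    · nlinarith
    · nlinarith
  · have hn' : (0 : ℝ) < n := by exact_mod_cast hn
    have h1 := hu.lim_le_div hbu hn.ne'
    have h2 := hv.lim_le_div hbv hn.ne'
    rw [le_div_iff₀ hn'] at h1 h2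
    rw [hlim] at h2
    simp only [u, v] at h1 h2
    constructor
    · rw [← le_log_iff_exp_le (ha n)]; linarith
    · rw [← log_le_iff_le_exp (mul_pos hc (ha n)), log_mul hc.ne' (ha n).ne']; linarith

theorem le_of_pow_le_const_mul_pow {x y K : ℝ} (hy : 0 < y)
    (h : ∀ n : ℕ, x ^ n ≤ K * y ^ n) : x ≤ y := by
  by_contra! hxy
  obtain ⟨n, hn⟩ := pow_unbounded_of_one_lt K ((one_lt_div hy).2 hxy)
  rw [div_pow, lt_div_iff₀ (by positivity)] at hn
  linarith [h n]

/-! ### Numerical bounds on the rate -/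

/-- A test function for `sinTransfer`. -/
noncomputable def sinTest (b x : ℝ) : ℝ := 1 + b * sin (π * x)

theorem sinTransfer_sinTest (b x : ℝ) :
    sinTransfer (sinTest b) x = ((sin (π / 2 * x) + cos (π / 2 * x)) + b) / 2 := by
  have h1 : sin (π * (x / 2)) = sin (π / 2 * x) := by ring_nf
  have h2 : sin (π * ((1 - x) / 2)) = cos (π / 2 * x) := by
    rw [← sin_pi_div_two_sub]; ring_nf
  simp only [sinTransfer, sinTest, h1, h2]
  linear_combination (b / 2) * sin_sq_add_cos_sq (π / 2 * x)

theorem sinTest_eq (b x : ℝ) :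
    sinTest b x = 1 + b * ((sin (π / 2 * x) + cos (π / 2 * x)) ^ 2 - 1) := by
  have h1 : sin (π * x) = 2 * sin (π / 2 * x) * cos (π / 2 * x) := by
    rw [← sin_two_mul]; ring_nf
  rw [sinTest, h1]
  linear_combination b * -sin_sq_add_cos_sq (π / 2 * x)

theorem sinTest_bounds {b x : ℝ} (hb : 0 ≤ b) (hx : x ∈ Icc (0 : ℝ) 1) :
    1 ≤ sinTest b x ∧ sinTest b x ≤ 1 + b := by
  have h0 : 0 ≤ sin (π * x) := sin_nonneg_of_nonneg_of_le_pi (mul_nonneg pi_pos.le hx.1)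
    (by nlinarith [pi_pos, hx.2])
  have h1 := sin_le_one (π * x)
  unfold sinTest
  constructor <;> nlinarith

theorem sinTransferMax_le (n : ℕ) : sinTransferMax n ≤ 1.29 * 0.6626 ^ n := by
  have h : ∀ x ∈ Icc (0 : ℝ) 1, sinTransfer (sinTest 0.29) x ≤ 0.6626 * sinTest 0.29 x := by
    intro x _
    rw [sinTransfer_sinTest, sinTest_eq]
    -- In `t = sin + cos` the difference of the two sides is a quadratic with vertex near `1.3`.
    nlinarith [sq_nonneg (sin (π / 2 * x) + cos (π / 2 * x) - 1.3)]
  have h1 := sinTransfer_iterate_mono (g := 1) (h := sinTest 0.29)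
    (fun x hx => (sinTest_bounds (by norm_num) hx).1) n (1 / 2) half_mem_Icc
  have h2 := sinTransfer_iterate_le_of_le (by norm_num) h n (1 / 2) half_mem_Icc
  have h3 := (sinTest_bounds (by norm_num : (0 : ℝ) ≤ 0.29) half_mem_Icc).2
  have h4 : (0.6626 : ℝ) ^ n * sinTest 0.29 (1 / 2) ≤ 0.6626 ^ n * (1 + 0.29) := by gcongr
  unfold sinTransferMax
  linarith

theorem le_sinTransferMax (n : ℕ) : 0.6545 ^ n ≤ 1.31 * sinTransferMax n := by
  have h : ∀ x ∈ Icc (0 : ℝ) 1, 0.6545 * sinTest 0.31 x ≤ sinTransfer (sinTest 0.31) x := by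
    intro x hx
    have hs := sin_pi_div_two_mul_nonneg hx
    have hc := cos_pi_div_two_mul_nonneg hx
    have hsq := sin_sq_add_cos_sq (π / 2 * x)
    rw [sinTransfer_sinTest, sinTest_eq]
    set t := sin (π / 2 * x) + cos (π / 2 * x) with ht
    have h1 : 1 ≤ t := by nlinarith [mul_nonneg hs hc]
    have h2 : t ≤ 1.4143 := by
      nlinarith [sq_nonneg (sin (π / 2 * x) - cos (π / 2 * x))]
    -- The difference is convex in `t`, so it suffices that the inequality holds at `1` and at
    -- `1.4143`, just above `√2`.
    nlinarith [mul_nonneg (sub_nonneg.2 h1) (sub_nonneg.2 h2)]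
  have h1 := sinTransfer_iterate_mono (g := sinTest 0.31) (h := (1.31 : ℝ) • 1)
    (fun x hx => by
      have := (sinTest_bounds (b := 0.31) (by norm_num) hx).2
      simp only [Pi.smul_apply, smul_eq_mul, Pi.one_apply]; linarith) n (1 / 2) half_mem_Icc
  have h2 := le_sinTransfer_iterate_of_le (by norm_num) h n (1 / 2) half_mem_Icc
  have h3 := (sinTest_bounds (by norm_num : (0 : ℝ) ≤ 0.31) half_mem_Icc).1
  have h4 : (0.6545 : ℝ) ^ n * 1 ≤ 0.6545 ^ n * sinTest 0.31 (1 / 2) := by gcongr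
  rw [sinTransfer_iterate_smul] at h1
  change _ ≤ 1.31 * sinTransferMax n at h1
  linarith

/-! ### Sine products and the transfer operator -/

/-- The integrand of `sinProdIntegral`. -/
noncomputable def sinProd (n : ℕ) (x : ℝ) : ℝ := ∏ k ∈ Finset.range n, |sin (2 ^ k * π * x)|

theorem sinProd_continuous (n : ℕ) : Continuous (sinProd n) := by
  unfold sinProd; fun_prop

theorem sinProd_succ (n : ℕ) (x : ℝ) : sinProd (n + 1) x = |sin (π * x)| * sinProd n (2 * x) := by
  rw [sinProd, Finset.prod_range_succ', mul_comm]
  simp only [sinProd, pow_zero, one_mul]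
  congr 1
  refine Finset.prod_congr rfl fun k _ => ?_
  ring_nf

theorem sinProd_one_sub (n : ℕ) (x : ℝ) : sinProd n (1 - x) = sinProd n x := by
  refine Finset.prod_congr rfl fun k _ => ?_
  have : 2 ^ k * π * (1 - x) = ((2 ^ k : ℕ) : ℝ) * π - 2 ^ k * π * x := by push_cast; ring
  rw [this, abs_sin_eq_sqrt_one_sub_cos_sq, abs_sin_eq_sqrt_one_sub_cos_sq, cos_nat_mul_pi_sub,
    mul_pow, ← pow_mul, mul_comm (2 ^ k) 2, pow_mul, neg_one_sq, one_pow, one_mul]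

/-- Symmetry folds the integral onto `[0, 1 / 2]`, the substitution `x = u / 2` unfolds it, and
averaging over `u` and `1 - u` yields `sinTransfer`. -/
theorem integral_mul_sinProd_succ {g : ℝ → ℝ} (hg : Continuous g) (hs : ∀ x, g (1 - x) = g x)
    (n : ℕ) : ∫ x in (0 : ℝ)..1, g x * sinProd (n + 1) x =
      ∫ x in (0 : ℝ)..1, sinTransfer g x * sinProd n x := by
  set F : ℝ → ℝ := fun x => g x * sinProd (n + 1) x
  have hF : Continuous F := hg.mul (sinProd_continuous _)
  have hFs : ∀ x, F (1 - x) = F x := fun x => by simp only [F, hs, sinProd_one_sub]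
  set H : ℝ → ℝ := fun u => g (u / 2) * sin (π / 2 * u) * sinProd n u
  have hH : Continuous H := by
    have := sinProd_continuous n
    simp only [H]; fun_prop
  have h1 : ∫ x in (1 / 2 : ℝ)..1, F x = ∫ x in (0 : ℝ)..(1 / 2), F x := by
    have := intervalIntegral.integral_comp_sub_left (a := 0) (b := 1 / 2) F 1
    simp only [hFs] at this
    rw [this]; norm_num
  have h2 : ∫ x in (0 : ℝ)..1, F x = 2 * ∫ x in (0 : ℝ)..(1 / 2), F x := by
    rw [← intervalIntegral.integral_add_adjacent_intervals (hF.intervalIntegrable 0 (1 / 2))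
      (hF.intervalIntegrable (1 / 2) 1), h1]
    ring
  have h3 : ∫ x in (0 : ℝ)..1, H x = 2 * ∫ x in (0 : ℝ)..(1 / 2), F x := by
    have := intervalIntegral.integral_comp_div (a := 0) (b := 1) F (two_ne_zero (α := ℝ))
    rw [zero_div, smul_eq_mul] at this
    rw [← this]
    refine intervalIntegral.integral_congr fun u hu => ?_
    rw [uIcc_of_le zero_le_one] at hu
    have e : π * (u / 2) = π / 2 * u := by ring
    simp only [F, H, sinProd_succ, e, abs_of_nonneg (sin_pi_div_two_mul_nonneg hu),
      mul_div_cancel₀ u (two_ne_zero (α := ℝ))]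
    ring
  have h4 : ∫ x in (0 : ℝ)..1, H (1 - x) = ∫ x in (0 : ℝ)..1, H x := by
    simp
  have h5 : ∫ x in (0 : ℝ)..1, sinTransfer g x * sinProd n x =
      ∫ x in (0 : ℝ)..1, (H x + H (1 - x)) / 2 := by
    refine intervalIntegral.integral_congr fun x _ => ?_
    have e : sin (π / 2 * (1 - x)) = cos (π / 2 * x) := by
      rw [← sin_pi_div_two_sub]; ring_nf
    simp only [H, e, sinProd_one_sub, sinTransfer]
    ring
  have hH' : Continuous fun x => H (1 - x) := by fun_prop
  rw [h5, intervalIntegral.integral_div, intervalIntegral.integral_add (hH.intervalIntegrable _ _)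
    (hH'.intervalIntegrable _ _), h4, h3, h2]
  ring

theorem integral_mul_sinProd {g : ℝ → ℝ} (hg : Continuous g) (hs : ∀ x, g (1 - x) = g x)
    (n : ℕ) : ∫ x in (0 : ℝ)..1, g x * sinProd n x = ∫ x in (0 : ℝ)..1, sinTransfer^[n] g x := by
  induction n generalizing g with
  | zero => simp [sinProd]
  | succ n ih =>
    rw [integral_mul_sinProd_succ hg hs, ih (sinTransfer_continuous hg) (sinTransfer_one_sub g)]
    rfl

theorem sinProdIntegral_eq (n : ℕ) :
    sinProdIntegral n = ∫ x in (0 : ℝ)..1, sinTransfer^[n] 1 x := by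
  rw [← integral_mul_sinProd (g := 1) continuous_const fun _ => rfl]
  simp [sinProdIntegral, sinProd]

theorem sinProdIntegral_bounds (n : ℕ) :
    sinTransferMax n / 2 ≤ sinProdIntegral n ∧ sinProdIntegral n ≤ sinTransferMax n := by
  have hc := (sinTransfer_iterate_continuous (g := 1) continuous_const n).intervalIntegrable
    (μ := MeasureTheory.volume) 0 1
  rw [sinProdIntegral_eq]
  constructor
  · have := intervalIntegral.integral_mono_on zero_le_one intervalIntegrable_const hc
      (half_max_le_sinTransfer_iterate n)
    simpa using this
  · have := intervalIntegral.integral_mono_on zero_le_one hc intervalIntegrable_const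
      (sinTransfer_iterate_le_max n)
    simpa using this

theorem IsSinProdRate.le {ρ σ : ℝ} (hρ : IsSinProdRate ρ) (hσ : IsSinProdRate σ) : ρ ≤ σ := by
  obtain ⟨h0, c, C, hc, hC, h⟩ := hρ
  obtain ⟨h0', c', C', hc', hC', h'⟩ := hσ
  refine le_of_pow_le_const_mul_pow (K := C' / c) h0' fun n => ?_
  rw [div_mul_eq_mul_div, le_div_iff₀ hc]
  linarith [(h n).1, (h' n).2]

theorem exists_isSinProdRate : ∃ ρ : ℝ, 0.6543 < ρ ∧ ρ < 0.6632 ∧ IsSinProdRate ρ := by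
  obtain ⟨ρ, h0, h⟩ := exists_rate_of_quasi_multiplicative (by norm_num : (0 : ℝ) < 1 / 2)
    sinTransferMax_pos sinTransferMax_add_le le_sinTransferMax_add
  have hlow : (0.6545 : ℝ) ≤ ρ :=
    le_of_pow_le_const_mul_pow (K := 2.62) h0 fun n => by
      linarith [(h n).2, le_sinTransferMax n]
  have hup : ρ ≤ 0.6626 :=
    le_of_pow_le_const_mul_pow (K := 1.29) (by norm_num) fun n =>
      (h n).1.trans (sinTransferMax_le n)
  refine ⟨ρ, by linarith, by linarith, h0, 1 / 2, 2, by norm_num, by norm_num, fun n => ?_⟩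
  have := sinProdIntegral_bounds n
  constructor
  · linarith [(h n).1]
  · linarith [(h n).2]

/-! ### Pointwise bound for the Thue–Morse sum -/

theorem binDigitSum_two_mul (m : ℕ) : binDigitSum (2 * m) = binDigitSum m := by
  rcases Nat.eq_zero_or_pos m with rfl | hm
  · rfl
  · have := Nat.digits_add 2 (by norm_num) 0 m (by norm_num) (Or.inr hm.ne')
    rw [zero_add] at this
    simp [binDigitSum, this]

theorem binDigitSum_two_mul_add_one (m : ℕ) :
    binDigitSum (2 * m + 1) = binDigitSum m + 1 := by
  have := Nat.digits_add 2 (by norm_num) 1 m (by norm_num) (Or.inl one_ne_zero)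
  rw [add_comm 1] at this
  rw [binDigitSum, this, List.sum_cons, add_comm, binDigitSum]

theorem unitExp_add (x y : ℝ) : unitExp (x + y) = unitExp x * unitExp y := by
  simp only [unitExp, ← Complex.exp_add]
  push_cast; ring_nf

theorem norm_one_sub_unitExp (x : ℝ) : ‖1 - unitExp x‖ = 2 * |sin (π * x)| := by
  have h : unitExp x = Complex.exp (Complex.I * ((2 * π * x : ℝ) : ℂ)) := by
    rw [unitExp]; push_cast; ring_nf
  rw [norm_sub_rev, h, Complex.norm_exp_I_mul_ofReal_sub_one, norm_mul, Real.norm_eq_abs,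
    Real.norm_eq_abs]
  norm_num
  ring_nf

/-- The general term of the Thue–Morse exponential sum. -/
noncomputable def thueMorseTerm (θ : ℝ) (m : ℕ) : ℂ := (-1 : ℂ) ^ binDigitSum m * unitExp ((m : ℝ) * θ)

theorem norm_thueMorseTerm (θ : ℝ) (m : ℕ) : ‖thueMorseTerm θ m‖ = 1 := by
  simp [thueMorseTerm, norm_unitExp]

theorem thueMorseTerm_two_mul (θ : ℝ) (m : ℕ) :
    thueMorseTerm θ (2 * m) + thueMorseTerm θ (2 * m + 1) =
      (1 - unitExp θ) * thueMorseTerm (2 * θ) m := by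
  have e1 : ((2 * m : ℕ) : ℝ) * θ = m * (2 * θ) := by push_cast; ring
  have e2 : ((2 * m + 1 : ℕ) : ℝ) * θ = m * (2 * θ) + θ := by push_cast; ring
  simp only [thueMorseTerm, binDigitSum_two_mul, binDigitSum_two_mul_add_one, e1, e2, unitExp_add]
  ring

theorem sum_Ico_two_mul {M : Type*} [AddCommMonoid M] (f : ℕ → M) (a b : ℕ) :
    ∑ m ∈ Finset.Ico (2 * a) (2 * b), f m =
      ∑ m ∈ Finset.Ico a b, (f (2 * m) + f (2 * m + 1)) := by
  rcases le_total b a with h | h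
  · rw [Finset.Ico_eq_empty_of_le h, Finset.Ico_eq_empty_of_le (by omega)]; rfl
  · induction b, h using Nat.le_induction with
    | base => simp
    | succ b hb ih =>
      rw [Finset.sum_Ico_succ_top hb, ← ih, mul_add, mul_one, ← add_assoc,
        Finset.sum_Ico_succ_top (by omega), Finset.sum_Ico_succ_top (by omega)]

theorem norm_sum_thueMorseTerm_le_length (θ : ℝ) (a b : ℕ) :
    ‖∑ m ∈ Finset.Ico a b, thueMorseTerm θ m‖ ≤ (b - a : ℕ) := by
  refine (norm_sum_le _ _).trans ?_
  simp [norm_thueMorseTerm]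

/-- Removing at most one term at either end leaves a sum over pairs `2 m, 2 m + 1`. -/
theorem norm_sum_thueMorseTerm_le_step (θ : ℝ) {a b : ℕ} (hab : a < b) :
    ‖∑ m ∈ Finset.Ico a b, thueMorseTerm θ m‖ ≤ 2 + 2 * |sin (π * θ)| *
      ‖∑ m ∈ Finset.Ico ((a + 1) / 2) (b / 2), thueMorseTerm (2 * θ) m‖ := by
  rw [← Finset.sum_Ico_consecutive _ (show a ≤ 2 * ((a + 1) / 2) by omega)
      (show 2 * ((a + 1) / 2) ≤ b by omega),
    ← Finset.sum_Ico_consecutive _ (show 2 * ((a + 1) / 2) ≤ 2 * (b / 2) by omega)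
      (show 2 * (b / 2) ≤ b by omega), sum_Ico_two_mul]
  simp only [thueMorseTerm_two_mul, ← Finset.mul_sum]
  have h1 := norm_sum_thueMorseTerm_le_length θ a (2 * ((a + 1) / 2))
  have h2 := norm_sum_thueMorseTerm_le_length θ (2 * (b / 2)) b
  have h3 : ((2 * ((a + 1) / 2) - a : ℕ) : ℝ) ≤ 1 := by
    exact_mod_cast (by omega : 2 * ((a + 1) / 2) - a ≤ 1)
  have h4 : ((b - 2 * (b / 2) : ℕ) : ℝ) ≤ 1 := by
    exact_mod_cast (by omega : b - 2 * (b / 2) ≤ 1)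
  refine (norm_add_le _ _).trans ((add_le_add_right (norm_add_le _ _) _).trans ?_)
  rw [norm_mul, norm_one_sub_unitExp]
  linarith

theorem norm_sum_thueMorseTerm_le (N : ℕ) (θ : ℝ) {a b : ℕ} (h : b - a ≤ 2 ^ N) :
    ‖∑ m ∈ Finset.Ico a b, thueMorseTerm θ m‖ ≤
      2 * ∑ l ∈ Finset.range (N + 1), 2 ^ l * sinProd l θ := by
  induction N generalizing θ a b with
  | zero =>
    refine (norm_sum_thueMorseTerm_le_length θ a b).trans ?_
    have : ((b - a : ℕ) : ℝ) ≤ 1 := by exact_mod_cast h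
    simp only [zero_add, Finset.range_one, Finset.sum_singleton, pow_zero, one_mul, sinProd,
      Finset.range_zero, Finset.prod_empty]
    linarith
  | succ N ih =>
    have hnn : ∀ n x, 0 ≤ sinProd n x := fun n x => Finset.prod_nonneg fun _ _ => abs_nonneg _
    rcases le_or_gt b a with hab | hab
    · rw [Finset.Ico_eq_empty_of_le hab, Finset.sum_empty, norm_zero]
      exact mul_nonneg zero_le_two (Finset.sum_nonneg fun l _ => mul_nonneg (by positivity)
        (hnn _ _))
    · refine (norm_sum_thueMorseTerm_le_step θ hab).trans ?_
      have h1 := ih (2 * θ) (a := (a + 1) / 2) (b := b / 2) (by rw [pow_succ] at h; omega)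
      have h2 := mul_le_mul_of_nonneg_left h1 (by positivity : 0 ≤ 2 * |sin (π * θ)|)
      have h3 : ∑ l ∈ Finset.range (N + 1 + 1), 2 ^ l * sinProd l θ =
          2 * |sin (π * θ)| * (∑ l ∈ Finset.range (N + 1), 2 ^ l * sinProd l (2 * θ)) + 1 := by
        rw [Finset.sum_range_succ', Finset.mul_sum]
        congr 1
        · refine Finset.sum_congr rfl fun l _ => ?_
          rw [sinProd_succ]; ring
        · simp [sinProd]
      rw [h3]
      linarith

theorem norm_thueMorseSum_le {x z : ℝ} (hx : 0 ≤ x) {N : ℕ} (hN : z + 1 ≤ 2 ^ N) (hz : 0 ≤ z)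
    (θ : ℝ) : ‖thueMorseSum x z θ‖ ≤ 2 * ∑ l ∈ Finset.range (N + 1), 2 ^ l * sinProd l θ := by
  have h1 : thueMorseSum x z θ = ∑ m ∈ Finset.Ico (⌊x⌋₊ + 1) (⌊x + z⌋₊ + 1), thueMorseTerm θ m := by
    rw [thueMorseSum]
    refine Finset.sum_congr ?_ fun _ _ => rfl
    ext m; simp only [Finset.mem_Ioc, Finset.mem_Ico]; omega
  rw [h1]
  refine norm_sum_thueMorseTerm_le N θ ?_
  have h2 := Nat.floor_le (add_nonneg hx hz)
  have h3 := Nat.lt_floor_add_one x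
  have h4 : (⌊x + z⌋₊ : ℝ) ≤ ((⌊x⌋₊ + 2 ^ N : ℕ) : ℝ) := by push_cast; linarith
  have h5 : ⌊x + z⌋₊ ≤ ⌊x⌋₊ + 2 ^ N := by exact_mod_cast h4
  rw [Nat.add_sub_add_right]
  exact Nat.sub_le_iff_le_add'.2 h5

/-! ### Integrating the supremum -/

theorem thueMorseSum_continuous (x z : ℝ) : Continuous (thueMorseSum x z) := by
  unfold thueMorseSum unitExp
  fun_prop

theorem thueMorseSup_intervalIntegrable {z : ℝ} (hz : 0 ≤ z) (a b : ℝ) :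
    IntervalIntegrable (fun θ : ℝ => thueMorseSup z θ) MeasureTheory.volume a b := by
  have hm : Measurable (fun θ : ℝ => thueMorseSup z θ) := by
    -- The supremum is over uncountably many `x`, so measurability comes from lower semicontinuity.
    refine LowerSemicontinuous.measurable ?_
    exact lowerSemicontinuous_ciSup (fun θ => thueMorseSup_bddAbove hz θ)
      fun x => (thueMorseSum_continuous x z).norm.lowerSemicontinuous
  obtain ⟨N, hN⟩ := pow_unbounded_of_one_lt (z + 1) (one_lt_two (α := ℝ))
  have hc : Continuous fun θ => 2 * ∑ l ∈ Finset.range (N + 1), 2 ^ l * sinProd l θ := by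
    have := sinProd_continuous
    fun_prop
  refine (hc.intervalIntegrable a b).mono_fun hm.aestronglyMeasurable
    (Filter.Eventually.of_forall fun θ => ?_)
  have h1 : thueMorseSup z θ ≤ 2 * ∑ l ∈ Finset.range (N + 1), 2 ^ l * sinProd l θ :=
    ciSup_le fun x => norm_thueMorseSum_le x.2 hN.le hz θ
  have h2 : 0 ≤ thueMorseSup z θ := Real.iSup_nonneg fun x => norm_nonneg _
  simp only [Real.norm_eq_abs, abs_of_nonneg h2]
  exact h1.trans (le_abs_self _)

theorem integral_thueMorseSup_le {z : ℝ} (hz : 0 ≤ z) {N : ℕ} (hN : z + 1 ≤ 2 ^ N) :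
    (∫ θ in (0 : ℝ)..1, thueMorseSup z θ) ≤
      2 * ∑ l ∈ Finset.range (N + 1), 2 ^ l * sinProdIntegral l := by
  have hi : ∀ l, IntervalIntegrable (fun θ => (2 : ℝ) ^ l * sinProd l θ) MeasureTheory.volume 0 1 :=
    fun l => ((sinProd_continuous l).const_mul _).intervalIntegrable 0 1
  have h1 : ∫ θ in (0 : ℝ)..1, 2 * ∑ l ∈ Finset.range (N + 1), 2 ^ l * sinProd l θ =
      2 * ∑ l ∈ Finset.range (N + 1), 2 ^ l * sinProdIntegral l := by
    rw [intervalIntegral.integral_const_mul, intervalIntegral.integral_finsetSum fun l _ => hi l]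
    simp only [intervalIntegral.integral_const_mul]
    rfl
  rw [← h1]
  have hc : Continuous fun θ => 2 * ∑ l ∈ Finset.range (N + 1), 2 ^ l * sinProd l θ := by
    have := sinProd_continuous
    fun_prop
  exact intervalIntegral.integral_mono_on zero_le_one (thueMorseSup_intervalIntegrable hz 0 1)
    (hc.intervalIntegrable 0 1) fun θ _ => ciSup_le fun x => norm_thueMorseSum_le x.2 hN hz θ

/-- The integral of `thueMorseSup` is bounded in terms of the rate of the sine products. -/
theorem IsSinProdRate.exists_integral_thueMorseSup_le {ρ : ℝ} (hρ : IsSinProdRate ρ)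
    (hρ2 : 1 / 2 < ρ) : ∃ C : ℝ, 0 < C ∧ ∀ z : ℝ, 1 ≤ z →
      (∫ θ in (0 : ℝ)..1, thueMorseSup z θ) ≤ C * z ^ (1 + log ρ / log 2) := by
  obtain ⟨h0, c, K, hc, hK, h⟩ := hρ
  have hr : 0 < 2 * ρ - 1 := by linarith
  refine ⟨2 * K * ((2 * ρ) ^ 3 / (2 * ρ - 1)), by positivity, fun z hz => ?_⟩
  obtain ⟨n, hn1, hn2⟩ := exists_nat_pow_near hz (one_lt_two (α := ℝ))
  -- The range of summation can hold up to `z + 1` integers, hence `n + 2` although `z < 2 ^ (n +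
  -- 1)`.
  have hN : z + 1 ≤ 2 ^ (n + 2) := by
    have h1 : (1 : ℝ) ≤ 2 ^ (n + 1) := one_le_pow₀ one_le_two
    rw [pow_succ]; linarith
  have h1 := integral_thueMorseSup_le (by linarith) hN
  have h2 : ∑ l ∈ Finset.range (n + 2 + 1), 2 ^ l * sinProdIntegral l ≤
      K * ∑ l ∈ Finset.range (n + 3), (2 * ρ) ^ l := by
    rw [Finset.mul_sum]
    refine Finset.sum_le_sum fun l _ => ?_
    calc (2 : ℝ) ^ l * sinProdIntegral l ≤ 2 ^ l * (K * ρ ^ l) := by gcongr; exact (h l).2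
      _ = K * (2 * ρ) ^ l := by rw [mul_pow]; ring
  have h3 : ∑ l ∈ Finset.range (n + 3), (2 * ρ) ^ l ≤ (2 * ρ) ^ (n + 3) / (2 * ρ - 1) := by
    rw [geom_sum_eq (by linarith)]
    gcongr
    linarith
  have h4 : (2 * ρ) ^ n ≤ z ^ (1 + log ρ / log 2) := by
    have hl2 : 0 < log 2 := log_pos one_lt_two
    have he : 1 + log ρ / log 2 = log (2 * ρ) / log 2 := by
      rw [log_mul two_ne_zero h0.ne']; field_simp
    have hpos : 0 ≤ log (2 * ρ) / log 2 := div_nonneg (log_nonneg (by linarith)) hl2.le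
    rw [he]
    refine le_trans (le_of_eq ?_) (rpow_le_rpow (by positivity) hn1 hpos)
    rw [← rpow_natCast 2 n, ← rpow_mul zero_le_two, rpow_def_of_pos two_pos,
      ← exp_log (by linarith : 0 < 2 * ρ), ← exp_nat_mul, exp_log (by linarith)]
    congr 1
    field_simp
  have h5 : (2 * ρ) ^ (n + 3) / (2 * ρ - 1) ≤
      (2 * ρ) ^ 3 / (2 * ρ - 1) * z ^ (1 + log ρ / log 2) := by
    rw [pow_add, div_mul_eq_mul_div, mul_comm ((2 * ρ) ^ n)]
    gcongr
  calc _ ≤ _ := h1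
    _ ≤ 2 * (K * ((2 * ρ) ^ 3 / (2 * ρ - 1) * z ^ (1 + log ρ / log 2))) := by
      have := mul_le_mul_of_nonneg_left (h3.trans h5) hK.le
      linarith
    _ = _ := by ring

theorem mainTheorem9 :
    ∃ ρ : ℝ, 0.6543 < ρ ∧ ρ < 0.6632 ∧
      IsSinProdRate ρ ∧ (∀ σ : ℝ, IsSinProdRate σ → σ = ρ) ∧
      ∃ C : ℝ, 0 < C ∧ ∀ z : ℝ, 1 ≤ z →
        IntervalIntegrable (fun θ : ℝ => thueMorseSup z θ) MeasureTheory.volume 0 1 ∧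
        (∫ θ in (0 : ℝ)..1, thueMorseSup z θ) ≤ C * z ^ (1 + Real.log ρ / Real.log 2) := by
  obtain ⟨ρ, h1, h2, hρ⟩ := exists_isSinProdRate
  obtain ⟨C, hC, h⟩ := hρ.exists_integral_thueMorseSup_le (by linarith)
  exact ⟨ρ, h1, h2, hρ, fun σ hσ => (hσ.le hρ).antisymm (hρ.le hσ), C, hC, fun z hz =>
    ⟨thueMorseSup_intervalIntegrable (by linarith) 0 1, h z hz⟩⟩
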